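/- Let $X_1,X_2,\dots$ be jointly normal random variables with $X_i\sim\mathcal N(\mu_i,1)$ and $\operatorname{Corr}(X_i,X_j)=\rho_{ij}\in(0,1]$ for $i\ne j$. For each $n$, let $\Sigma_n$ be the correlation matrix of $(X_1,\dots,X_n)$, let $\Phi$ be the standard normal distribution function, and consider the null hypotheses $H_{0i}:\mu_i=0$, with intersection null hypothesis $H_0$: $\mu_i=0$ for all $i$. For a positive integer $k$ and $\alpha\in(0,1)$, the $k$-FWER of the Lehmann–Romano procedure, which rejects $H_{0i}$ when $X_i>\Phi^{-1}(1-k\alpha/n)$, is $$k\text{-}FWER(n,\alpha,\Sigma_n)=\mathbb P_{H_0}\big(X_i>\Phi^{-1}(1-k\alpha/n)\ \text{for at least } k \text{ indices } i\in\{1,\dots,n\}\big).$$ Suppose that $$\liminf_{\substack{i,j\to\infty\\ i\neq j}}\rho_{ij}=\delta>0,$$ where $i,j\to\infty$ means $\min(i,j)\to\infty$. Then, for every $\alpha\in(0,1)$ and every positive integer $k$ with $k\alpha<1$, $$\lim_{n\to\infty}k\text{-}FWER(n,\alpha,\Sigma_n)=0.$$ -/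

import Mathlib

open MeasureTheory ProbabilityTheory Filter Topology

noncomputable section

/-- The cumulative distribution function `Φ` of the standard normal distribution. -/
def stdNormalCDF (x : ℝ) : ℝ := cdf (gaussianReal 0 1) x

/-- The standard normal quantile function `Φ⁻¹(p) = inf {x : p ≤ Φ(x)}`. For `p ∈ (0, 1)` it is
the inverse of the continuous strictly increasing function `Φ`, cf. `stdNormalCDF_quantile`. -/
def stdNormalQuantile (p : ℝ) : ℝ := sInf {x : ℝ | p ≤ stdNormalCDF x}

theorem continuous_stdNormalCDF : Continuous stdNormalCDF := by
  have : NullSingletonClass (gaussianReal 0 1) := nullSingletonClass_gaussianReal one_ne_zero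
  rw [continuous_iff_continuousAt]
  intro x
  have h1 : (cdf (gaussianReal 0 1)).measure {x} = 0 := by
    rw [measure_cdf]; exact measure_singleton x
  rw [StieltjesFunction.measure_singleton, ENNReal.ofReal_eq_zero] at h1
  have hm := monotone_cdf (gaussianReal 0 1)
  have h2 : Function.leftLim (cdf (gaussianReal 0 1)) x = cdf (gaussianReal 0 1) x :=
    le_antisymm (hm.leftLim_le le_rfl) (by linarith)
  have h3 : ContinuousAt (cdf (gaussianReal 0 1)) x := by
    rw [hm.continuousAt_iff_leftLim_eq_rightLim, h2, StieltjesFunction.rightLim_eq]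
  exact h3

theorem stdNormalCDF_quantile {p : ℝ} (hp : p ∈ Set.Ioo (0 : ℝ) 1) :
    stdNormalCDF (stdNormalQuantile p) = p := by
  have hm : Monotone stdNormalCDF := monotone_cdf (gaussianReal 0 1)
  have hbot : Tendsto stdNormalCDF atBot (𝓝 0) := tendsto_cdf_atBot _
  have htop : Tendsto stdNormalCDF atTop (𝓝 1) := tendsto_cdf_atTop _
  obtain ⟨b, hb⟩ := (htop.eventually (eventually_gt_nhds hp.2)).exists
  obtain ⟨a, ha⟩ := (hbot.eventually (eventually_lt_nhds hp.1)).exists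
  have hne : {x : ℝ | p ≤ stdNormalCDF x}.Nonempty := ⟨b, hb.le⟩
  have hbdd : BddBelow {x : ℝ | p ≤ stdNormalCDF x} :=
    ⟨a, fun x hx => le_of_lt (hm.reflect_lt (lt_of_lt_of_le ha hx))⟩
  have hmem : p ≤ stdNormalCDF (stdNormalQuantile p) :=
    (isClosed_le continuous_const continuous_stdNormalCDF).csInf_mem hne hbdd
  obtain ⟨y, hy⟩ := mem_range_of_exists_le_of_exists_ge continuous_stdNormalCDF
    ⟨a, ha.le⟩ ⟨b, hb.le⟩
  refine le_antisymm ?_ hmem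
  have hle : stdNormalQuantile p ≤ y := csInf_le hbdd hy.ge
  exact (hm hle).trans hy.le

/-- Pearson correlation coefficient of two real random variables. -/
def pearsonCorr {Ω : Type*} [MeasurableSpace Ω] (P : Measure Ω) (Y Z : Ω → ℝ) : ℝ :=
  cov[Y, Z; P] / (Real.sqrt Var[Y; P] * Real.sqrt Var[Z; P])

/-- The arbitrarily correlated normal model: `X 0, X 1, …` are jointly normal,
`X i ∼ N(μ i, 1)`, and `Corr(X i, X j) = ρ i j` for `i ≠ j`. The diagonal values of `ρ` play
no role. -/
structure IsCorrelatedNormalModel {Ω : Type*} [MeasurableSpace Ω] (P : Measure Ω)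
    (X : ℕ → Ω → ℝ) (μ : ℕ → ℝ) (ρ : ℕ → ℕ → ℝ) : Prop where
  jointlyGaussian : IsGaussianProcess X P
  marginal : ∀ i, HasLaw (X i) (gaussianReal (μ i) 1) P
  corr : ∀ i j, i ≠ j → pearsonCorr P (X i) (X j) = ρ i j

/-- The intersection null hypothesis: all means vanish. -/
def GlobalNull (μ : ℕ → ℝ) : Prop := ∀ i, μ i = 0

/-- The cutoff `Φ⁻¹(1 - kα/n)` of the Lehmann–Romano procedure. -/
def lehmannRomanoCutoff (k n : ℕ) (α : ℝ) : ℝ := stdNormalQuantile (1 - k * α / n)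

/-- The probability, under `P`, that the Lehmann–Romano procedure applied to the first `n`
variables rejects at least `k` of the `n` hypotheses. When `P` is a law satisfying the
intersection null hypothesis, this is the `k`-FWER. -/
def kFWER {Ω : Type*} [MeasurableSpace Ω] (P : Measure Ω) (X : ℕ → Ω → ℝ)
    (k n : ℕ) (α : ℝ) : ℝ :=
  P.real {ω | k ≤ ((Finset.range n).filter
    (fun i => lehmannRomanoCutoff k n α < X i ω)).card}

end

/-!
The idea is to compare all late variables with a single one of them. A positive limit inferior of
the correlations yields an index `m` and a number `ε ∈ (0, 1)` with `ρ i m > ε` for all `i > m`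
(`exists_forall_lt_correlation`). Under the null hypothesis the residual `X i - ρ i m * X m` is then
centred normal with variance `1 - (ρ i m)² ≤ 1 - ε²`, strictly and uniformly below `1`
(`IsCorrelatedNormalModel.measureReal_residual_ge_le`).

Fix `t ≥ 0` and let `c` be the cutoff, whose normal tail `1 - Φ(c)` is `kα/n`. If `X i > c` with
`i > m` and `X m ≤ t`, then the residual of `X i` is at least `c - t`. A union bound
(`IsCorrelatedNormalModel.kFWER_le`) thus gives
`kFWER ≤ (m + 1) (1 - Φ(c)) + (1 - Φ(t)) + n exp(-(c - t)² / (2 (1 - ε²)))`.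
The first term is `(m + 1) kα/n`, and since `n = kα / (1 - Φ(c))`, the third one is, up to a
constant, the ratio of a shifted normal tail of variance `1 - ε² < 1` to the standard normal tail,
which tends to `0` (`tendsto_exp_div_one_sub_stdNormalCDF`). So the upper limit of the `kFWER` is at
most `1 - Φ(t)`, and `t` is arbitrary. Since one rejection is already unlikely, `k` enters only
through the cutoff; no Gaussian comparison inequality and no independence are needed.
-/

/-! ### The tail of the standard normal distribution -/

theorem measureReal_lt_eq_one_sub_stdNormalCDF {Ω : Type*} [MeasurableSpace Ω] {P : Measure Ω}
    {Y : Ω → ℝ} (hY : HasLaw Y (gaussianReal 0 1) P) (x : ℝ) :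
    P.real {ω | x < Y ω} = 1 - stdNormalCDF x := by
  have h : {ω | x < Y ω} = Y ⁻¹' Set.Ioi x := rfl
  rw [h, ← map_measureReal_apply_of_aemeasurable hY.aemeasurable measurableSet_Ioi, hY.map_eq,
    stdNormalCDF, cdf_eq_real, ← Set.compl_Iic, probReal_compl_eq_one_sub measurableSet_Iic]

/-- The tail `1 - Φ(x)` is at least the integral of the decreasing density over `[x, x + 1]`. -/
theorem exp_le_one_sub_stdNormalCDF {x : ℝ} (hx : 0 ≤ x) :
    (√(2 * Real.pi))⁻¹ * Real.exp (-(x + 1) ^ 2 / 2) ≤ 1 - stdNormalCDF x := by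
  have h1 : 1 - stdNormalCDF x = (gaussianReal 0 1).real (Set.Ioi x) := by
    rw [stdNormalCDF, cdf_eq_real, ← Set.compl_Iic, probReal_compl_eq_one_sub measurableSet_Iic]
  have h2 : (gaussianReal 0 1).real (Set.Ioc x (x + 1))
      = ∫ y in Set.Ioc x (x + 1), gaussianPDFReal 0 1 y := by
    rw [Measure.real, gaussianReal_apply_eq_integral 0 one_ne_zero, ENNReal.toReal_ofReal]
    exact integral_nonneg fun y => gaussianPDFReal_nonneg _ _ y
  have h3 : ∫ _ in Set.Ioc x (x + 1), (√(2 * Real.pi))⁻¹ * Real.exp (-(x + 1) ^ 2 / 2)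
      ≤ ∫ y in Set.Ioc x (x + 1), gaussianPDFReal 0 1 y := by
    refine setIntegral_mono_on (integrable_const _)
      (integrable_gaussianPDFReal 0 1).integrableOn measurableSet_Ioc fun y hy => ?_
    have hy1 : y ^ 2 ≤ (x + 1) ^ 2 := pow_le_pow_left₀ (hx.trans hy.1.le) hy.2 2
    simp only [gaussianPDFReal, NNReal.coe_one, mul_one, sub_zero]
    gcongr
  rw [h1]
  refine le_trans ?_ (measureReal_mono (Set.Ioc_subset_Ioi_self (a := x + 1)))
  rw [h2]
  simpa using h3

theorem one_sub_stdNormalCDF_pos (x : ℝ) : 0 < 1 - stdNormalCDF x := by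
  have h : stdNormalCDF x ≤ stdNormalCDF (max x 0) := monotone_cdf _ (le_max_left x 0)
  have h2 := exp_le_one_sub_stdNormalCDF (le_max_right x 0)
  have h3 : 0 < (√(2 * Real.pi))⁻¹ * Real.exp (-(max x 0 + 1) ^ 2 / 2) := by positivity
  linarith

/-- A centred normal tail with variance `v < 1`, even after a shift by a constant, is negligible
compared with the standard normal tail. -/
theorem tendsto_exp_div_one_sub_stdNormalCDF {v : ℝ} (hv : 0 < v) (hv1 : v < 1) (t : ℝ) :
    Tendsto (fun x => Real.exp (-(x - t) ^ 2 / (2 * v)) / (1 - stdNormalCDF x)) atTop (𝓝 0) := by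
  have hexp : Tendsto (fun x : ℝ => (x + 1) ^ 2 / 2 - (x - t) ^ 2 / (2 * v)) atTop atBot := by
    have ha : (1 - 1 / v) / 2 < 0 := by
      have := one_lt_one_div hv hv1
      linarith
    have h1 : Tendsto (fun x : ℝ => (1 - 1 / v) / 2 * x + (1 + t / v)) atTop atBot :=
      tendsto_atBot_add_const_right _ _ (tendsto_id.const_mul_atTop_of_neg ha)
    have h2 := tendsto_atBot_add_const_right _ (1 / 2 - t ^ 2 / (2 * v))
      (tendsto_id.atTop_mul_atBot₀ h1)
    refine h2.congr fun x => ?_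
    simp only [id]
    field
  have hlim : Tendsto (fun x : ℝ => √(2 * Real.pi) *
      Real.exp ((x + 1) ^ 2 / 2 - (x - t) ^ 2 / (2 * v))) atTop (𝓝 0) := by
    simpa using (Real.tendsto_exp_atBot.comp hexp).const_mul √(2 * Real.pi)
  refine squeeze_zero' (Eventually.of_forall fun x =>
    div_nonneg (Real.exp_pos _).le (one_sub_stdNormalCDF_pos x).le) ?_ hlim
  filter_upwards [eventually_ge_atTop 0] with x hx
  have hpi : 0 < √(2 * Real.pi) := by positivity
  rw [div_le_iff₀ (one_sub_stdNormalCDF_pos x)]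
  refine le_trans (le_of_eq ?_)
    (mul_le_mul_of_nonneg_left (exp_le_one_sub_stdNormalCDF hx) (by positivity))
  rw [mul_mul_mul_comm, mul_inv_cancel₀ hpi.ne', one_mul, ← Real.exp_add]
  congr 1
  ring

/-! ### The Lehmann–Romano cutoff -/

theorem one_sub_stdNormalCDF_lehmannRomanoCutoff {α : ℝ} {k n : ℕ} (hα : 0 < α) (hk : 0 < k)
    (hkα : (k : ℝ) * α < 1) (hn : 0 < n) :
    1 - stdNormalCDF (lehmannRomanoCutoff k n α) = k * α / n := by
  have hk' : (0 : ℝ) < k := Nat.cast_pos.2 hk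
  have hn' : (1 : ℝ) ≤ n := Nat.one_le_cast.2 hn
  have h1 : 0 < k * α / n := by positivity
  have h2 : k * α / n < 1 := by
    rw [div_lt_one (by linarith)]
    linarith
  rw [lehmannRomanoCutoff, stdNormalCDF_quantile ⟨by linarith, by linarith⟩]
  ring

theorem tendsto_lehmannRomanoCutoff {α : ℝ} {k : ℕ} (hα : 0 < α) (hk : 0 < k)
    (hkα : (k : ℝ) * α < 1) :
    Tendsto (fun n => lehmannRomanoCutoff k n α) atTop atTop := by
  refine tendsto_atTop.2 fun b => ?_
  filter_upwards [(tendsto_const_div_atTop_nhds_zero_nat ((k : ℝ) * α)).eventually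
    (eventually_lt_nhds (one_sub_stdNormalCDF_pos b)), eventually_gt_atTop 0] with n hn hn0
  rw [← one_sub_stdNormalCDF_lehmannRomanoCutoff hα hk hkα hn0] at hn
  have hm : Monotone stdNormalCDF := monotone_cdf (gaussianReal 0 1)
  exact (hm.reflect_lt (by linarith)).le

/-! ### Regression residuals in the correlated normal model -/

/-- Under the intersection null hypothesis, the residual `X i - ρ i m * X m` of the regression of
`X i` on `X m` is centred normal with variance `1 - (ρ i m)²`. -/
theorem IsCorrelatedNormalModel.hasLaw_residual {Ω : Type*} [MeasurableSpace Ω] {P : Measure Ω}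
    {X : ℕ → Ω → ℝ} {μ : ℕ → ℝ} {ρ : ℕ → ℕ → ℝ} (hX : IsCorrelatedNormalModel P X μ ρ)
    (hH0 : GlobalNull μ) {i m : ℕ} (him : i ≠ m) :
    HasLaw (fun ω => X i ω - ρ i m * X m ω)
      (gaussianReal 0 (1 - ρ i m ^ 2).toNNReal) P := by
  have hP : IsProbabilityMeasure P := hX.jointlyGaussian.isProbabilityMeasure
  have hG (j : ℕ) : HasGaussianLaw (X j) P := hX.jointlyGaussian.hasGaussianLaw_eval j
  have hmean (j : ℕ) : P[X j] = 0 := by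
    rw [(hX.marginal j).integral_eq, integral_id_gaussianReal, hH0 j]
  have hvar (j : ℕ) : Var[X j; P] = 1 := by
    rw [(hX.marginal j).variance_eq, variance_id_gaussianReal, NNReal.coe_one]
  have hcov : cov[X i, X m; P] = ρ i m := by
    have h := hX.corr i m him
    simpa [pearsonCorr, hvar] using h
  have hR : HasGaussianLaw (fun ω => X i ω - ρ i m * X m ω) P := by
    have h := (hX.jointlyGaussian.smul fun j => if j = m then ρ i m else 1).hasGaussianLaw_fun_sub
      (s := i) (t := m)
    simpa [him] using h
  refine ⟨hR.aemeasurable, ?_⟩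
  rw [hR.map_eq_gaussianReal, integral_sub (hG i).integrable ((hG m).integrable.const_mul _),
    integral_const_mul, hmean, hmean,
    variance_fun_sub (hG i).memLp_two ((hG m).memLp_two.const_mul _),
    variance_const_mul, covariance_const_mul_right, hvar, hvar, hcov]
  congr 2 <;> ring

/-- If `ρ i m ≥ ε`, the residual of `X i` on `X m` has variance at most `1 - ε²`, so it satisfies
the corresponding Chernoff bound. -/
theorem IsCorrelatedNormalModel.measureReal_residual_ge_le {Ω : Type*} [MeasurableSpace Ω]
    {P : Measure Ω} {X : ℕ → Ω → ℝ} {μ : ℕ → ℝ} {ρ : ℕ → ℕ → ℝ}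
    (hX : IsCorrelatedNormalModel P X μ ρ) (hH0 : GlobalNull μ) {i m : ℕ} (him : i ≠ m)
    {ε : ℝ} (hε : 0 ≤ ε) (hε1 : ε ≤ 1) (hρ : ε ≤ ρ i m) {s : ℝ} (hs : 0 ≤ s) :
    P.real {ω | s ≤ X i ω - ρ i m * X m ω} ≤ Real.exp (-s ^ 2 / (2 * (1 - ε ^ 2))) := by
  have hlaw := hX.hasLaw_residual hH0 him
  have hε2 : 0 ≤ 1 - ε ^ 2 := by nlinarith
  have hle : (1 - ρ i m ^ 2).toNNReal ≤ (1 - ε ^ 2).toNNReal := by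
    gcongr
  have hsub : HasSubgaussianMGF (fun ω => X i ω - ρ i m * X m ω) (1 - ε ^ 2).toNNReal P := by
    constructor
    · intro t
      have h : Integrable (fun x => Real.exp (t * x)) (P.map fun ω => X i ω - ρ i m * X m ω) := by
        rw [hlaw.map_eq]
        exact integrable_exp_mul_gaussianReal t
      exact h.comp_aemeasurable hlaw.aemeasurable
    · intro t
      rw [mgf_gaussianReal hlaw.map_eq, zero_mul, zero_add]
      gcongr
  simpa only [Real.coe_toNNReal _ hε2] using hsub.measure_ge_le hs

/-! ### The family-wise error rate -/

/-- At least `k ≥ 1` exceedances of the cutoff `c` among the first `n` variables force one of the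
following: an exceedance by some `X i` with `i ≤ m`, or `X m > t`, or a residual of some `X i`
with `i > m` of size at least `c - t`. -/
theorem IsCorrelatedNormalModel.kFWER_le {Ω : Type*} [MeasurableSpace Ω]
    {P : Measure Ω} {X : ℕ → Ω → ℝ} {μ : ℕ → ℝ} {ρ : ℕ → ℕ → ℝ}
    (hX : IsCorrelatedNormalModel P X μ ρ) (hH0 : GlobalNull μ) {m : ℕ} {ε : ℝ} (hε : 0 ≤ ε)
    (hε1 : ε ≤ 1) (hρ : ∀ i, m < i → ρ i m ∈ Set.Icc ε 1) {k n : ℕ} (hk : 0 < k) {α t : ℝ}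
    (ht : 0 ≤ t) (htc : t ≤ lehmannRomanoCutoff k n α) :
    kFWER P X k n α ≤ (m + 1) * (1 - stdNormalCDF (lehmannRomanoCutoff k n α))
      + (1 - stdNormalCDF t)
      + n * Real.exp (-(lehmannRomanoCutoff k n α - t) ^ 2 / (2 * (1 - ε ^ 2))) := by
  have hP : IsProbabilityMeasure P := hX.jointlyGaussian.isProbabilityMeasure
  have hlaw (j : ℕ) : HasLaw (X j) (gaussianReal 0 1) P := by
    have h := hX.marginal j
    rwa [hH0 j] at h
  rw [kFWER]
  set c := lehmannRomanoCutoff k n α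
  have hsubset : {ω | k ≤ ((Finset.range n).filter (fun i => c < X i ω)).card} ⊆
      ((⋃ i ∈ Finset.range (m + 1), {ω | c < X i ω}) ∪ {ω | t < X m ω}) ∪
      ⋃ i ∈ (Finset.range n).filter (m < ·), {ω | c - t ≤ X i ω - ρ i m * X m ω} := by
    intro ω hω
    obtain ⟨i, hi⟩ := Finset.card_pos.1 (hk.trans_le hω)
    obtain ⟨hin, hci⟩ := Finset.mem_filter.1 hi
    rcases lt_or_ge m i with hmi | hmi
    · rcases lt_or_ge t (X m ω) with htm | htm
      · exact Or.inl (Or.inr htm)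
      · refine Or.inr (Set.mem_biUnion (Finset.mem_coe.2 (Finset.mem_filter.2 ⟨hin, hmi⟩)) ?_)
        -- `ρ * X m ≤ ρ * t ≤ t`, where the second step needs `0 ≤ t`.
        have h1 : ρ i m * X m ω ≤ t :=
          (mul_le_mul_of_nonneg_left htm (hε.trans (hρ i hmi).1)).trans
            (mul_le_of_le_one_left ht (hρ i hmi).2)
        change c - t ≤ X i ω - ρ i m * X m ω
        linarith
    · exact Or.inl (Or.inl (Set.mem_biUnion
        (Finset.mem_coe.2 (Finset.mem_range.2 (Nat.lt_succ_of_le hmi))) hci))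
  refine (measureReal_mono hsubset).trans ((measureReal_union_le _ _).trans
    (add_le_add ((measureReal_union_le _ _).trans (add_le_add ?_ ?_)) ?_))
  · refine (measureReal_biUnion_finset_le _ _).trans (le_of_eq ?_)
    simp only [measureReal_lt_eq_one_sub_stdNormalCDF (hlaw _)]
    rw [Finset.sum_const, Finset.card_range, nsmul_eq_mul, Nat.cast_add_one]
  · rw [measureReal_lt_eq_one_sub_stdNormalCDF (hlaw m)]
  · refine (measureReal_biUnion_finset_le _ _).trans ((Finset.sum_le_card_nsmul _ _
      (Real.exp (-(c - t) ^ 2 / (2 * (1 - ε ^ 2)))) fun i hi => ?_).trans ?_)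
    · have hmi := (Finset.mem_filter.1 hi).2
      exact hX.measureReal_residual_ge_le hH0 hmi.ne' hε hε1 (hρ i hmi).1 (by linarith)
    · rw [nsmul_eq_mul]
      gcongr
      exact (Finset.card_filter_le _ _).trans (Finset.card_range n).le

/-- A positive limit inferior gives a variable `X m` whose correlation with every later variable
exceeds a fixed positive number. -/
theorem exists_forall_lt_correlation {ρ : ℕ → ℕ → ℝ} (hρ : ∀ i j, i ≠ j → 0 < ρ i j) {ε : ℝ}
    (hlim : ε < liminf (fun p : ℕ × ℕ => ρ p.1 p.2)
      ((atTop : Filter (ℕ × ℕ)) ⊓ 𝓟 {p : ℕ × ℕ | p.1 ≠ p.2})) :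
    ∃ m, ∀ i, m < i → ε < ρ i m := by
  have hbdd : ((atTop : Filter (ℕ × ℕ)) ⊓ 𝓟 {p : ℕ × ℕ | p.1 ≠ p.2}).IsBoundedUnder (· ≥ ·)
      (fun p : ℕ × ℕ => ρ p.1 p.2) := by
    refine isBoundedUnder_of_eventually_ge (a := 0) ?_
    rw [eventually_inf_principal]
    exact Eventually.of_forall fun p hp => (hρ _ _ hp).le
  have h := eventually_lt_of_lt_liminf hlim hbdd
  rw [eventually_inf_principal, eventually_atTop] at h
  obtain ⟨⟨a, b⟩, hab⟩ := h
  refine ⟨max a b, fun i hi => hab (i, max a b) ⟨?_, le_max_right a b⟩ hi.ne'⟩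
  exact (le_max_left a b).trans hi.le

theorem corollary4p1 {Ω : Type*} [MeasurableSpace Ω] (P : Measure Ω) [IsProbabilityMeasure P]
    (X : ℕ → Ω → ℝ) (μ : ℕ → ℝ) (ρ : ℕ → ℕ → ℝ)
    (hX : IsCorrelatedNormalModel P X μ ρ) (hH0 : GlobalNull μ)
    (hρ : ∀ i j, i ≠ j → ρ i j ∈ Set.Ioc (0 : ℝ) 1)
    (δ : ℝ) (hδ : 0 < δ)
    (hlim : liminf (fun p : ℕ × ℕ => ρ p.1 p.2)
      ((atTop : Filter (ℕ × ℕ)) ⊓ 𝓟 {p : ℕ × ℕ | p.1 ≠ p.2}) = δ)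
    (α : ℝ) (hα : α ∈ Set.Ioo (0 : ℝ) 1) (k : ℕ) (hk : 0 < k) (hkα : (k : ℝ) * α < 1) :
    Tendsto (fun n : ℕ => kFWER P X k n α) atTop (𝓝 0) := by
  -- `ε < 1` also in the case `δ = 1`, so that `1 - ε²` is a positive bound on the variances.
  obtain ⟨ε, hε, hεmin⟩ := exists_between (lt_min hδ one_pos)
  obtain ⟨hεδ, hε1⟩ := lt_min_iff.1 hεmin
  obtain ⟨m, hm⟩ := exists_forall_lt_correlation (fun i j hij => (hρ i j hij).1)
    (hεδ.trans_eq hlim.symm)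
  have hv : 0 < 1 - ε ^ 2 := by nlinarith
  have hv1 : 1 - ε ^ 2 < 1 := by nlinarith
  have hc := tendsto_lehmannRomanoCutoff hα.1 hk hkα
  have hΦ : Tendsto (fun t => 1 - stdNormalCDF t) atTop (𝓝 0) := by
    simpa [stdNormalCDF] using (tendsto_cdf_atTop (gaussianReal 0 1)).const_sub 1
  refine tendsto_order.2 ⟨fun a ha => Eventually.of_forall fun n =>
    ha.trans_le measureReal_nonneg, fun η hη => ?_⟩
  obtain ⟨t, htη, ht⟩ := ((hΦ.eventually (eventually_lt_nhds hη)).and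
    (eventually_ge_atTop 0)).exists
  have hbound : Tendsto (fun n : ℕ => ((m : ℝ) + 1) * (k * α / n) + (1 - stdNormalCDF t)
      + k * α * (Real.exp (-(lehmannRomanoCutoff k n α - t) ^ 2 / (2 * (1 - ε ^ 2)))
        / (1 - stdNormalCDF (lehmannRomanoCutoff k n α)))) atTop (𝓝 (1 - stdNormalCDF t)) := by
    simpa using (((tendsto_const_div_atTop_nhds_zero_nat ((k : ℝ) * α)).const_mul
      ((m : ℝ) + 1)).add_const (1 - stdNormalCDF t)).add
      (((tendsto_exp_div_one_sub_stdNormalCDF hv hv1 t).comp hc).const_mul ((k : ℝ) * α))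
  filter_upwards [hbound.eventually (eventually_lt_nhds htη), hc.eventually_ge_atTop t,
    eventually_gt_atTop 0] with n hn htc hn0
  refine lt_of_le_of_lt ?_ hn
  have h := hX.kFWER_le hH0 hε.le hε1.le
    (fun i hi => ⟨(hm i hi).le, (hρ i m hi.ne').2⟩) hk ht htc
  have hα0 : α ≠ 0 := hα.1.ne'
  rw [one_sub_stdNormalCDF_lehmannRomanoCutoff hα.1 hk hkα hn0] at h ⊢
  refine h.trans (le_of_eq ?_)
  congr 1
  field_simp
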